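/- Let $d\ge 1$, $n,m\ge 0$ be integers, let $\mathcal H=(\mathbb C^d)^{\otimes n}$, and for linear operators $A$ on $\mathcal H$ put $\|A\|_2=\big(d^{-n}\operatorname{Tr}(A^\dagger A)\big)^{1/2}$ and let $\|A\|_\infty$ be the operator norm. Let $X|j\rangle=|j+1 \bmod d\rangle$ and $Z|j\rangle=e^{2\pi \mathrm i j/d}|j\rangle$ on $\mathbb C^d$, and for $\vec a=((s_1,t_1),\dots,(s_n,t_n))\in(\mathbb Z_d\times\mathbb Z_d)^n$ let $P_{\vec a}=\bigotimes_{i=1}^n X^{s_i}Z^{t_i}$. The total influence of a linear operator $O$ on $\mathcal H$ is $$I[O]=\sum_{j=1}^n\ \sum_{\vec a:\,a_j\ne(0,0)}\frac{1}{d^{2n}}\,|\operatorname{Tr}(OP_{\vec a})|^2 ,$$ and the circuit sensitivity of a unitary $U$ on $\mathcal H$ is $$\mathrm{CiS}[U]=\max_{O:\ \|O\|_2=1}\big|\,I[UOU^\dagger]-I[O]\,\big| .$$ Let $h_1,\dots,h_m$ be traceless Hermitian operators on $\mathcal H$ with $\|h_j\|_\infty=1$, each of them supported on (at most) $2$ qudits,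 i.e. of the form $h_S\otimes I_{S^c}$ with $|S|\le 2$. For $U\in \mathrm{SU}(d^n)$ the circuit cost of $U$ with respect to $h_1,\dots,h_m$ is $$\mathrm{Cost}(U)=\inf\int_0^1\sum_{j=1}^m|r_j(s)|\,\mathrm ds\ \in[0,\infty],$$ where the infimum is over all continuous functions $r_1,\dots,r_m:[0,1]\to\mathbb R$ such that $U=\mathcal P\exp\big(-\mathrm i\int_0^1H(s)\,\mathrm ds\big)$ with $H(s)=\sum_{j=1}^m r_j(s)h_j$; that is, $U=V(1)$ for the solution $V$ of $V'(s)=-\mathrm i H(s)V(s)$, $V(0)=I$, on $[0,1]$ (the infimum is $\infty$ if there are no such functions). Then, for every $U\in\mathrm{SU}(d^n)$, the maximum defining $\mathrm{CiS}[U]$ is attained, and $$\mathrm{Cost}(U)\ \ge\ \tfrac18\,\mathrm{CiS}[U].$$ -/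

import Mathlib

open scoped ENNReal Matrix

noncomputable section

namespace QuditCircuit

/-- Labels of the computational basis of the `n`-qudit space `(ℂ^d)^{⊗ n}`. -/
abbrev QIdx (n d : ℕ) : Type := Fin n → ZMod d

/-- Linear operators on `(ℂ^d)^{⊗ n}`, written in the computational basis. -/
abbrev Op (n d : ℕ) : Type := Matrix (QIdx n d) (QIdx n d) ℂ

variable {n d : ℕ} [NeZero d]

/-- The normalized inner product `⟨A, B⟩ = d^{-n} Tr (A† B)`. -/
def opInner (A B : Op n d) : ℂ := (1 / (d : ℂ) ^ n) * (Aᴴ * B).trace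

/-- The norm `‖A‖₂ = √⟨A, A⟩`. -/
def norm2 (A : Op n d) : ℝ := Real.sqrt (opInner A A).re

/-- The shift operator `X |j⟩ = |j + 1 mod d⟩`. -/
def shiftX (d : ℕ) : Matrix (ZMod d) (ZMod d) ℂ :=
  Matrix.of fun i j => if i = j + 1 then 1 else 0

/-- The clock operator `Z |j⟩ = exp (2 π i j / d) |j⟩`. -/
def clockZ (d : ℕ) : Matrix (ZMod d) (ZMod d) ℂ :=
  Matrix.diagonal fun j => Complex.exp (2 * Complex.I * (j.val : ℂ) * (Real.pi : ℂ) / (d : ℂ))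

/-- The one-qudit generalized Pauli operator `X^s Z^t`. -/
def pauli1 (a : ZMod d × ZMod d) : Matrix (ZMod d) (ZMod d) ℂ :=
  shiftX d ^ a.1.val * clockZ d ^ a.2.val

/-- The `n`-qudit generalized Pauli operator `P_a = ⨂ᵢ P_{aᵢ}`. -/
def pauli (a : Fin n → ZMod d × ZMod d) : Op n d :=
  Matrix.of fun x y => ∏ i, pauli1 (a i) (x i) (y i)

/-- `P_O[a] = d^{-2n} |Tr (O P_a)|²`. -/
def pauliWeight (O : Op n d) (a : Fin n → ZMod d × ZMod d) : ℝ :=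
  (1 / (d : ℝ) ^ (2 * n)) * ‖(O * pauli a).trace‖ ^ 2

/-- The local influence of `O` at the `j`-th qudit. -/
def localInfluence (j : Fin n) (O : Op n d) : ℝ :=
  ∑ a : Fin n → ZMod d × ZMod d with a j ≠ (0, 0), pauliWeight O a

/-- The total influence of `O`. -/
def influence (O : Op n d) : ℝ := ∑ j : Fin n, localInfluence j O

/-- The values `|I[U O U†] - I[O]|` over all operators `O` with `‖O‖₂ = 1`. -/
def influenceChanges (U : Op n d) : Set ℝ :=
  {c | ∃ O : Op n d, norm2 O = 1 ∧ c = |influence (U * O * Uᴴ) - influence O|}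

/-- The circuit sensitivity. -/
def CiS (U : Op n d) : ℝ := sSup (influenceChanges U)

/-- `A = A_S ⊗ I` for some operator `A_S` on the qudits in `S`. -/
def SupportedOn (S : Finset (Fin n)) (A : Op n d) : Prop :=
  ∃ AS : Matrix (S → ZMod d) (S → ZMod d) ℂ, ∀ x y : QIdx n d,
    A x y = if ∀ i, i ∉ S → x i = y i then AS (fun i => x i) (fun i => y i) else 0

/-- The operator norm `‖A‖_∞` on the Hilbert space `(ℂ^d)^{⊗ n}`. -/
def opNorm (A : Op n d) : ℝ := ‖Matrix.toEuclideanCLM (n := QIdx n d) (𝕜 := ℂ) A‖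

/-- `U = 𝒫 exp (-i ∫₀¹ H(s) ds)`: `U` is the value at time `1` of the solution on `[0, 1]`
of `V'(s) = -i H(s) V(s)`, `V(0) = 1`. -/
def IsPathOrderedExp (H : ℝ → Op n d) (U : Op n d) : Prop :=
  ∃ V : ℝ → Op n d, V 0 = 1 ∧ V 1 = U ∧
    ∀ s ∈ Set.Icc (0 : ℝ) 1, ∀ x y : QIdx n d,
      HasDerivWithinAt (fun t => V t x y) ((-Complex.I • (H s * V s)) x y) (Set.Icc 0 1) s

/-- Nielsen's circuit cost of `U` with respect to `h₁, …, h_m`; it is `∞` if no continuous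
control functions generate `U`. -/
def cost {m : ℕ} (h : Fin m → Op n d) (U : Op n d) : ℝ≥0∞ :=
  ⨅ (r : Fin m → ℝ → ℝ) (_ : ∀ j, ContinuousOn (r j) (Set.Icc 0 1))
    (_ : IsPathOrderedExp (fun s => ∑ j, (r j s : ℂ) • h j) U),
    ENNReal.ofReal (∫ s in (0 : ℝ)..1, ∑ j, |r j s|)

end QuditCircuit

end

/-!
The total influence is a sum of local influences, and the local influence of `O` at the `j`-th
qudit is the quadratic form `⟨O, O - E_j O⟩`, where `E_j` is the normalized partial trace over the
`j`-th qudit tensored with the identity (`influenceForm_eq`). This follows from the completeness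
relation of the Pauli operators, in the versions for all of them (`sum_pauli_mul_star`) and for
those that are trivial at `j` (`sum_pauli_mul_star_of_trivial`).

Along a solution of `V' = -i H V`, the operator `O(s) = V O V†` keeps its norm and satisfies
`O' = -i [H, O]`, so the influence changes at the rate
`2 ∑_k r_k ∑_j Re ⟨O, (1 - E_j)(-i [h_k, O])⟩`. If `h_k` acts trivially on the `j`-th qudit, it
commutes with the matrix units on that qudit, and the term `(k, j)` vanishes
(`influenceForm_commutator_eq_zero`). There remain at most two values of `j` for each `k`, and
there Cauchy-Schwarz and `‖h O‖₂, ‖O h‖₂ ≤ ‖h‖_∞ ‖O‖₂` bound the real part by `2`. The influence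
therefore changes at a rate of at most `2 · 2 · 2 ∑_k |r_k|`, and integration over `[0, 1]` gives
the lower bound on the cost (`abs_influence_sub_le`). The maximum in the circuit sensitivity is
attained because the unit sphere of `‖·‖₂` is compact and the influence is continuous.
-/

namespace QuditCircuit

variable {n d : ℕ} [NeZero d]

/-! ### Completeness of the generalized Pauli operators -/

lemma shiftX_pow_apply (k : ℕ) (x y : ZMod d) :
    (shiftX d ^ k) x y = if x = y + k then 1 else 0 := by
  induction k generalizing x y with
  | zero => simp [Matrix.one_apply]
  | succ k ih =>
    have h1 : ∀ z, shiftX d z y = if z = y + 1 then 1 else 0 := fun z => rfl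
    rw [pow_succ, Matrix.mul_apply]
    simp only [ih, h1, mul_ite, mul_one, mul_zero, Finset.sum_ite_eq', Finset.mem_univ, if_true]
    push_cast
    rw [add_assoc, add_comm (1 : ZMod d)]

lemma clockZ_pow (k : ℕ) :
    clockZ d ^ k = Matrix.diagonal fun j => ZMod.stdAddChar ((k : ZMod d) * j) := by
  rw [clockZ, Matrix.diagonal_pow]
  congr 1
  funext j
  rw [Pi.pow_apply, ← nsmul_eq_mul, AddChar.map_nsmul_eq_pow]
  congr 1
  conv_rhs => rw [← ZMod.natCast_zmod_val j]
  rw [← Int.cast_natCast (R := ZMod d), ZMod.stdAddChar_coe]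
  congr 1
  push_cast
  ring

lemma pauli1_apply (a : ZMod d × ZMod d) (x y : ZMod d) :
    pauli1 a x y = if x = y + a.1 then ZMod.stdAddChar (a.2 * y) else 0 := by
  rw [pauli1, clockZ_pow, Matrix.mul_diagonal, shiftX_pow_apply]
  simp

/-- Completeness of the one-qudit Pauli operators: they form an orthogonal basis of the
operators on `ℂ^d`, each of squared Hilbert-Schmidt norm `d`. The exponent `s` of `X^s Z^t` is
forced to be `x - y`, and the sum over `t` is a character sum. -/
lemma sum_pauli1_mul_star (x y x' y' : ZMod d) :
    ∑ a : ZMod d × ZMod d, pauli1 a x y * star (pauli1 a x' y') =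
      if x = x' ∧ y = y' then (d : ℂ) else 0 := by
  have key : ∀ s : ZMod d, ∑ t : ZMod d, pauli1 (s, t) x y * star (pauli1 (s, t) x' y') =
      if s = x - y then (if x = x' ∧ y = y' then (d : ℂ) else 0) else 0 := by
    intro s
    simp only [pauli1_apply]
    by_cases h1 : x = y + s
    · have hs : s = x - y := by rw [h1]; ring
      by_cases h2 : x' = y' + s
      · have hxy : (x = x' ∧ y = y') ↔ y - y' = 0 := by
          constructor
          · rintro ⟨-, h⟩; rw [h, sub_self]
          · intro h
            have h := sub_eq_zero.1 h
            exact ⟨by rw [h1, h2, h], h⟩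
        have hsum := AddChar.sum_mulShift (y - y') (ZMod.isPrimitive_stdAddChar d)
        rw [ZMod.card] at hsum
        rw [if_pos hs]
        simp only [if_pos h1, if_pos h2, hxy]
        push_cast at hsum
        rw [← hsum]
        refine Finset.sum_congr rfl fun t _ => ?_
        rw [Complex.star_def, ← AddChar.map_neg_eq_conj, ← AddChar.map_add_eq_mul]
        congr 1; ring
      · have : ¬ (x = x' ∧ y = y') := by
          rintro ⟨h, h'⟩; exact h2 (by rw [← h, ← h', h1])
        simp [h2, this]
    · have hs : s ≠ x - y := by rintro rfl; exact h1 (by ring)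
      simp [h1, hs]
  rw [Fintype.sum_prod_type]
  simp only [key]
  simp

lemma pauli1_zero (x y : ZMod d) :
    pauli1 ((0, 0) : ZMod d × ZMod d) x y = if x = y then 1 else 0 := by
  simp [pauli1_apply]

lemma sum_pauli_mul_star_piFinset (T : Fin n → Finset (ZMod d × ZMod d)) (x y x' y' : QIdx n d) :
    ∑ a ∈ Fintype.piFinset T, (pauli a : Op n d) x y * star ((pauli a : Op n d) x' y') =
      ∏ i, ∑ b ∈ T i, pauli1 b (x i) (y i) * star (pauli1 b (x' i) (y' i)) := by
  rw [Finset.prod_univ_sum]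
  refine Finset.sum_congr rfl fun a _ => ?_
  simp only [pauli, Matrix.of_apply, star_prod, Finset.prod_mul_distrib]

lemma sum_pauli_mul_star (x y x' y' : QIdx n d) :
    ∑ a, (pauli a : Op n d) x y * star ((pauli a : Op n d) x' y') =
      if x = x' ∧ y = y' then (d : ℂ) ^ n else 0 := by
  have h := sum_pauli_mul_star_piFinset (fun _ : Fin n => Finset.univ) x y x' y'
  rw [Fintype.piFinset_univ] at h
  rw [h]
  simp only [sum_pauli1_mul_star]
  by_cases hxy : x = x' ∧ y = y'
  · obtain ⟨rfl, rfl⟩ := hxy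
    simp
  · rw [if_neg hxy]
    obtain ⟨i, hi⟩ : ∃ i, ¬ (x i = x' i ∧ y i = y' i) := by
      by_contra! hc
      exact hxy ⟨funext fun i => (hc i).1, funext fun i => (hc i).2⟩
    exact Finset.prod_eq_zero (Finset.mem_univ i) (if_neg hi)

/-- The matrix unit `|c⟩⟨e|` acting on the `j`-th qudit, tensored with the identity on the
others. -/
def siteUnit (j : Fin n) (c e : ZMod d) : Op n d :=
  Matrix.of fun x y => if x j = c ∧ y j = e ∧ ∀ i, i ≠ j → x i = y i then 1 else 0

/-- Completeness of the Pauli operators that are trivial on the `j`-th qudit. The right-hand side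
is the kernel of the partial trace over that qudit, followed by tensoring with the identity. -/
lemma sum_pauli_mul_star_of_trivial (j : Fin n) (p q u v : QIdx n d) :
    (d : ℂ) * ∑ a with a j = (0, 0), (pauli a : Op n d) v u * star ((pauli a : Op n d) q p) =
      (d : ℂ) ^ n * ∑ c, ∑ e, (siteUnit j c e : Op n d) p u * (siteUnit j e c : Op n d) v q := by
  have hT : (Finset.univ.filter fun a : Fin n → ZMod d × ZMod d => a j = (0, 0)) =
      Fintype.piFinset
        (Function.update (fun _ : Fin n => (.univ : Finset (ZMod d × ZMod d))) j {(0, 0)}) := by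
    ext a
    simp only [Finset.mem_filter, Finset.mem_univ, true_and, Fintype.mem_piFinset]
    constructor
    · intro h i
      by_cases hi : i = j
      · subst hi; simp [h]
      · simp [hi]
    · intro h
      simpa using h j
  rw [hT, sum_pauli_mul_star_piFinset, ← Finset.mul_prod_erase _ _ (Finset.mem_univ j)]
  have herase : ∏ i ∈ Finset.univ.erase j,
      ∑ b ∈ Function.update (fun _ : Fin n => (.univ : Finset (ZMod d × ZMod d))) j
        {((0 : ZMod d), (0 : ZMod d))} i,
        pauli1 b (v i) (u i) * star (pauli1 b (q i) (p i)) =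
      ∏ i ∈ Finset.univ.erase j, if v i = q i ∧ u i = p i then (d : ℂ) else 0 := by
    refine Finset.prod_congr rfl fun i hi => ?_
    rw [Function.update_of_ne (Finset.ne_of_mem_erase hi), sum_pauli1_mul_star]
  rw [herase]
  simp only [Function.update_self, Finset.sum_singleton, pauli1_zero]
  have hR : ∀ c e, (siteUnit j c e : Op n d) p u * (siteUnit j e c : Op n d) v q =
      if e = u j then (if c = p j then
        (if (v j = u j ∧ q j = p j) ∧ ∀ i, i ≠ j → v i = q i ∧ u i = p i then 1 else 0)
          else 0) else 0 := by
    intro c e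
    simp only [siteUnit, Matrix.of_apply, mul_ite, mul_one, mul_zero]
    split_ifs <;> grind
  simp only [hR, Finset.sum_ite_eq', Finset.mem_univ, if_true]
  by_cases hall : ∀ i, i ≠ j → v i = q i ∧ u i = p i
  · have : ∏ i ∈ Finset.univ.erase j, (if v i = q i ∧ u i = p i then (d : ℂ) else 0) =
        (d : ℂ) ^ (n - 1) := by
      rw [Finset.prod_congr rfl fun i hi => if_pos (hall i (Finset.ne_of_mem_erase hi))]
      simp [Finset.card_erase_of_mem]
    have hn : (d : ℂ) ^ n = d * (d : ℂ) ^ (n - 1) := by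
      rw [← pow_succ', Nat.sub_add_cancel (Fin.pos j)]
    rw [this, hn]
    by_cases h1 : v j = u j <;> by_cases h2 : q j = p j <;> simp +contextual [h1, h2, hall]
  · have hne : ¬ ((v j = u j ∧ q j = p j) ∧ ∀ i, i ≠ j → v i = q i ∧ u i = p i) :=
      fun h => hall h.2
    rw [if_neg hne]
    push Not at hall
    obtain ⟨i, hij, hi⟩ := hall
    have hi' : ¬ (v i = q i ∧ u i = p i) := fun h => hi h.1 h.2
    rw [Finset.prod_eq_zero (i := i) (Finset.mem_erase.2 ⟨hij, Finset.mem_univ i⟩) (if_neg hi')]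
    simp

/-! ### Sesquilinear forms of Pauli weights -/

/-- The sesquilinear form `∑_{a ∈ T} d^{-2n} conj (Tr (A P_a)) Tr (B P_a)`, conjugate-linear in
`A`; on the diagonal it is the total Pauli weight carried by `T`. -/
noncomputable def pauliForm (T : Finset (Fin n → ZMod d × ZMod d)) (A B : Op n d) : ℂ :=
  (1 / (d : ℂ) ^ (2 * n)) * ∑ a ∈ T, star (A * pauli a).trace * (B * pauli a).trace

lemma pauliForm_eq_sum_entries (T : Finset (Fin n → ZMod d × ZMod d)) (A B : Op n d) :
    pauliForm T A B = (1 / (d : ℂ) ^ (2 * n)) * ∑ p, ∑ q, ∑ u, ∑ v, star (A p q) * B u v *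
      ∑ a ∈ T, (pauli a : Op n d) v u * star ((pauli a : Op n d) q p) := by
  rw [pauliForm]
  congr 1
  have h : ∀ a, star (A * pauli a).trace * (B * pauli a).trace = ∑ p, ∑ q, ∑ u, ∑ v,
      star (A p q) * B u v * ((pauli a : Op n d) v u * star ((pauli a : Op n d) q p)) := by
    intro a
    rw [mul_comm]
    simp only [Matrix.trace, Matrix.diag, Matrix.mul_apply, star_sum, Finset.sum_mul,
      Finset.mul_sum, star_mul']
    refine Finset.sum_congr rfl fun p _ => Finset.sum_congr rfl fun q _ =>
      Finset.sum_congr rfl fun u _ => Finset.sum_congr rfl fun v _ => ?_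
    ring
  simp only [h, Finset.mul_sum]
  rw [Finset.sum_comm]
  refine Finset.sum_congr rfl fun p _ => ?_
  rw [Finset.sum_comm]
  refine Finset.sum_congr rfl fun q _ => ?_
  rw [Finset.sum_comm]
  refine Finset.sum_congr rfl fun u _ => ?_
  rw [Finset.sum_comm]

lemma trace_conjTranspose_mul_mul_mul (A L B M : Op n d) :
    (Aᴴ * L * B * M).trace =
      ∑ p, ∑ q, ∑ u, ∑ v, star (A p q) * B u v * (L p u * M v q) := by
  rw [Finset.sum_comm]
  simp only [Matrix.trace, Matrix.diag, Matrix.mul_apply, Finset.sum_mul,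
    Matrix.conjTranspose_apply]
  refine Finset.sum_congr rfl fun q _ => ?_
  rw [Finset.sum_comm, Finset.sum_comm (γ := QIdx n d) (s := Finset.univ) (t := Finset.univ)
    (f := fun p u => ∑ v, star (A p q) * B u v * (L p u * M v q))]
  refine Finset.sum_congr rfl fun u _ => ?_
  rw [Finset.sum_comm]
  refine Finset.sum_congr rfl fun p _ => Finset.sum_congr rfl fun v _ => ?_
  ring

lemma opInner_eq_sum (A B : Op n d) :
    opInner A B = (1 / (d : ℂ) ^ n) * ∑ p, ∑ q, star (A p q) * B p q := by
  rw [opInner, Finset.sum_comm]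
  simp only [Matrix.trace, Matrix.diag, Matrix.mul_apply, Matrix.conjTranspose_apply]

/-- Parseval's identity for the Pauli expansion, in polarized form. -/
lemma pauliForm_univ (A B : Op n d) : pauliForm Finset.univ A B = opInner A B := by
  have hd : (d : ℂ) ≠ 0 := Nat.cast_ne_zero.2 (NeZero.ne d)
  rw [pauliForm_eq_sum_entries, opInner_eq_sum]
  simp only [sum_pauli_mul_star, Finset.mul_sum]
  refine Finset.sum_congr rfl fun p _ => Finset.sum_congr rfl fun q _ => ?_
  have h : ∀ u v : QIdx n d, 1 / (d : ℂ) ^ (2 * n) * (star (A p q) * B u v *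
      if v = q ∧ u = p then (d : ℂ) ^ n else 0) =
      if v = q then (if u = p then 1 / (d : ℂ) ^ n * (star (A p q) * B p q) else 0) else 0 := by
    intro u v
    by_cases hu : u = p
    · by_cases hv : v = q
      · subst hu hv
        simp only [and_self, if_true]
        field_simp
        ring
      · simp [hv]
    · simp [hu]
  simp only [h, Finset.sum_ite_eq', Finset.mem_univ, if_true]

/-- The part of the Pauli expansion that is trivial on the `j`-th qudit is given by the partial
trace over that qudit. -/
lemma pauliForm_trivial (j : Fin n) (A B : Op n d) :
    pauliForm (Finset.univ.filter fun a => a j = (0, 0)) A B =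
      (1 / (d : ℂ) ^ (n + 1)) *
        ∑ c, ∑ e, (Aᴴ * siteUnit j c e * B * siteUnit j e c).trace := by
  have hd : (d : ℂ) ≠ 0 := Nat.cast_ne_zero.2 (NeZero.ne d)
  have hR : ∑ c, ∑ e, (Aᴴ * siteUnit j c e * B * siteUnit j e c).trace =
      ∑ p, ∑ q, ∑ u, ∑ v, star (A p q) * B u v *
        ∑ c, ∑ e, (siteUnit j c e : Op n d) p u * (siteUnit j e c : Op n d) v q := by
    simp only [trace_conjTranspose_mul_mul_mul, Finset.mul_sum]
    simp only [Finset.sum_comm (s := (Finset.univ : Finset (ZMod d)))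
      (t := (Finset.univ : Finset (QIdx n d)))]
  rw [pauliForm_eq_sum_entries, hR]
  simp only [Finset.mul_sum (a := 1 / (d : ℂ) ^ (2 * n)),
    Finset.mul_sum (a := 1 / (d : ℂ) ^ (n + 1))]
  refine Finset.sum_congr rfl fun p _ => Finset.sum_congr rfl fun q _ =>
    Finset.sum_congr rfl fun u _ => Finset.sum_congr rfl fun v _ => ?_
  have h := sum_pauli_mul_star_of_trivial j p q u v
  rw [mul_comm, ← eq_div_iff hd] at h
  rw [h]
  field_simp
  ring

/-- The sesquilinear form whose diagonal values are the local influences at the `j`-th qudit. -/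
noncomputable def influenceForm (j : Fin n) (A B : Op n d) : ℂ :=
  pauliForm (Finset.univ.filter fun a => a j ≠ (0, 0)) A B

/-- The form is `⟨A, B - E_j B⟩`, with `E_j` the normalized partial trace over the `j`-th qudit,
tensored with the identity. -/
lemma influenceForm_eq (j : Fin n) (A B : Op n d) :
    influenceForm j A B = (1 / (d : ℂ) ^ n) * (Aᴴ * B).trace - (1 / (d : ℂ) ^ (n + 1)) *
        ∑ c, ∑ e, (Aᴴ * siteUnit j c e * B * siteUnit j e c).trace := by
  have h1 := pauliForm_univ A B
  rw [opInner] at h1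
  rw [← h1, ← pauliForm_trivial, influenceForm, pauliForm, pauliForm, pauliForm,
    ← Finset.sum_filter_add_sum_filter_not Finset.univ (fun a => a j = (0, 0))]
  ring

lemma sum_pauliWeight (T : Finset (Fin n → ZMod d × ZMod d)) (O : Op n d) :
    ∑ a ∈ T, pauliWeight O a = (pauliForm T O O).re := by
  have h : pauliForm T O O = ((∑ a ∈ T, pauliWeight O a : ℝ) : ℂ) := by
    simp only [pauliForm, pauliWeight, Finset.mul_sum, Complex.ofReal_sum, Complex.ofReal_mul,
      Complex.star_def, Complex.conj_mul']
    push_cast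
    rfl
  rw [h, Complex.ofReal_re]

lemma pauliWeight_nonneg (O : Op n d) (a : Fin n → ZMod d × ZMod d) : 0 ≤ pauliWeight O a := by
  unfold pauliWeight; positivity

lemma norm2_eq_sqrt_sum (O : Op n d) : norm2 O = √(∑ a, pauliWeight O a) := by
  rw [sum_pauliWeight, pauliForm_univ, norm2]

/-- The Cauchy-Schwarz inequality; a partial sum of Pauli weights is at most `‖·‖₂²`. -/
lemma norm_pauliForm_le (T : Finset (Fin n → ZMod d × ZMod d)) (A B : Op n d) :
    ‖pauliForm T A B‖ ≤ norm2 A * norm2 B := by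
  have hterm : ∀ a, ‖(1 / (d : ℂ) ^ (2 * n)) *
      (star (A * pauli a).trace * (B * pauli a).trace)‖ =
      √(pauliWeight A a) * √(pauliWeight B a) := by
    intro a
    rw [← Real.sqrt_mul (pauliWeight_nonneg A a), pauliWeight, pauliWeight]
    symm
    rw [Real.sqrt_eq_iff_mul_self_eq (by positivity) (by positivity)]
    simp only [norm_mul, norm_div, norm_pow, norm_one, Complex.norm_natCast, norm_star]
    ring
  calc ‖pauliForm T A B‖ ≤ ∑ a ∈ T, √(pauliWeight A a) * √(pauliWeight B a) := by
        rw [pauliForm, Finset.mul_sum]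
        refine (norm_sum_le _ _).trans (le_of_eq ?_)
        exact Finset.sum_congr rfl fun a _ => hterm a
    _ ≤ ∑ a, √(pauliWeight A a) * √(pauliWeight B a) :=
        Finset.sum_le_sum_of_subset_of_nonneg (Finset.subset_univ T)
          fun a _ _ => by positivity
    _ ≤ norm2 A * norm2 B := by
        rw [norm2_eq_sqrt_sum, norm2_eq_sqrt_sum]
        exact Real.sum_sqrt_mul_sqrt_le _ (pauliWeight_nonneg A) (pauliWeight_nonneg B)

/-! ### Invariance under operators supported off a qudit -/

lemma commute_siteUnit {S : Finset (Fin n)} {h : Op n d} (hS : SupportedOn S h) {j : Fin n}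
    (hj : j ∉ S) (c e : ZMod d) : h * siteUnit j c e = siteUnit j c e * h := by
  obtain ⟨k, hk⟩ := hS
  ext x y
  have hL : (h * siteUnit j c e) x y =
      if y j = e then h x (Function.update y j c) else 0 := by
    rw [Matrix.mul_apply, Finset.sum_eq_single (Function.update y j c)]
    · by_cases hy : y j = e
      · simp +contextual [siteUnit, hy]
      · simp [siteUnit, hy]
    · intro z _ hz
      have : ¬ (z j = c ∧ y j = e ∧ ∀ i, i ≠ j → z i = y i) := by
        rintro ⟨h1, -, h2⟩
        refine hz (funext fun i => ?_)
        by_cases hi : i = j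
        · subst hi; simp [h1]
        · simp [hi, h2 i hi]
      simp [siteUnit, this]
    · simp
  have hR : (siteUnit j c e * h) x y =
      if x j = c then h (Function.update x j e) y else 0 := by
    rw [Matrix.mul_apply, Finset.sum_eq_single (Function.update x j e)]
    · by_cases hy : x j = c
      · simp +contextual [siteUnit, hy]
      · simp [siteUnit, hy]
    · intro z _ hz
      have : ¬ (x j = c ∧ z j = e ∧ ∀ i, i ≠ j → x i = z i) := by
        rintro ⟨-, h1, h2⟩
        refine hz (funext fun i => ?_)
        by_cases hi : i = j
        · subst hi; simp [h1]
        · simp [hi, h2 i hi]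
      simp [siteUnit, this]
    · simp
  have hx : (fun i : S => Function.update x j e i) = fun i : S => x i :=
    funext fun i => Function.update_of_ne (fun h' => hj (by rw [← h']; exact i.2)) _ _
  have hy : (fun i : S => Function.update y j c i) = fun i : S => y i :=
    funext fun i => Function.update_of_ne (fun h' => hj (by rw [← h']; exact i.2)) _ _
  rw [hL, hR, hk, hk, hx, hy]
  have hcond : (y j = e ∧ ∀ i, i ∉ S → x i = Function.update y j c i) ↔
      (x j = c ∧ ∀ i, i ∉ S → Function.update x j e i = y i) := by
    -- As `j ∉ S`, the condition at `j` can be separated from those at the other sites.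
    have aux : ∀ P : Fin n → Prop, (∀ i, i ∉ S → P i) ↔ P j ∧ ∀ i, i ≠ j → i ∉ S → P i := by
      intro P
      constructor
      · exact fun hP => ⟨hP j hj, fun i _ => hP i⟩
      · rintro ⟨h1, h2⟩ i hi
        by_cases hij : i = j
        · rwa [hij]
        · exact h2 i hij hi
    rw [aux, aux]
    simp +contextual only [ne_eq, Function.update_self, not_false_eq_true,
      Function.update_of_ne]
    tauto
  rw [← ite_and, ← ite_and]
  simp only [hcond]

/-- Left multiplication by `h` is self-adjoint for the form: `h` commutes with the partial trace
over a qudit on which it acts trivially. -/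
lemma influenceForm_mul_left {S : Finset (Fin n)} {h : Op n d} (hh : h.IsHermitian)
    (hS : SupportedOn S h) {j : Fin n} (hj : j ∉ S) (A B : Op n d) :
    influenceForm j (h * A) B = influenceForm j A (h * B) := by
  have hc := commute_siteUnit hS hj
  simp only [influenceForm_eq, Matrix.conjTranspose_mul, hh.eq]
  have : ∀ c e, (Aᴴ * h * siteUnit j c e * B * siteUnit j e c).trace =
      (Aᴴ * siteUnit j c e * (h * B) * siteUnit j e c).trace := by
    intro c e
    rw [Matrix.mul_assoc Aᴴ h, hc]
    simp only [Matrix.mul_assoc]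
  simp only [this]
  rw [Matrix.mul_assoc]

lemma influenceForm_mul_right {S : Finset (Fin n)} {h : Op n d} (hh : h.IsHermitian)
    (hS : SupportedOn S h) {j : Fin n} (hj : j ∉ S) (A B : Op n d) :
    influenceForm j (A * h) B = influenceForm j A (B * h) := by
  have hc := commute_siteUnit hS hj
  simp only [influenceForm_eq, Matrix.conjTranspose_mul, hh.eq]
  have h1 : ∀ c e, (h * Aᴴ * siteUnit j c e * B * siteUnit j e c).trace =
      (Aᴴ * siteUnit j c e * (B * h) * siteUnit j e c).trace := by
    intro c e
    rw [Matrix.mul_assoc, Matrix.mul_assoc, Matrix.mul_assoc, Matrix.trace_mul_comm]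
    simp only [Matrix.mul_assoc, hc]
  have h2 : (h * Aᴴ * B).trace = (Aᴴ * (B * h)).trace := by
    rw [Matrix.mul_assoc, Matrix.trace_mul_comm, Matrix.mul_assoc]
  simp only [h1, h2]

lemma pauliForm_add_right (T : Finset (Fin n → ZMod d × ZMod d)) (A B C : Op n d) :
    pauliForm T A (B + C) = pauliForm T A B + pauliForm T A C := by
  simp only [pauliForm, Matrix.add_mul, Matrix.trace_add, mul_add, Finset.sum_add_distrib]

lemma pauliForm_smul_right (T : Finset (Fin n → ZMod d × ZMod d)) (A B : Op n d) (z : ℂ) :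
    pauliForm T A (z • B) = z * pauliForm T A B := by
  simp only [pauliForm, Matrix.smul_mul, Matrix.trace_smul, smul_eq_mul, Finset.mul_sum]
  refine Finset.sum_congr rfl fun a _ => ?_
  ring

lemma star_pauliForm (T : Finset (Fin n → ZMod d × ZMod d)) (A B : Op n d) :
    star (pauliForm T A B) = pauliForm T B A := by
  simp only [pauliForm, star_mul', star_sum, star_star, star_div₀, star_one, star_pow,
    star_natCast]
  congr 1
  exact Finset.sum_congr rfl fun a _ => mul_comm _ _

/-- A commutator with a Hermitian operator supported off the `j`-th qudit does not change the
local influence at `j` to first order: `ad_h` is self-adjoint for the form, so that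
`⟨O, [h, O]⟩` is real. -/
lemma influenceForm_commutator_eq_zero {S : Finset (Fin n)} {h : Op n d} (hh : h.IsHermitian)
    (hS : SupportedOn S h) {j : Fin n} (hj : j ∉ S) (O : Op n d) :
    (influenceForm j O (-Complex.I • (h * O - O * h))).re = 0 := by
  have h1 : influenceForm j O (h * O - O * h) =
      influenceForm j O (h * O) - influenceForm j O (O * h) := by
    have := pauliForm_add_right (Finset.univ.filter fun a => a j ≠ (0, 0)) O (h * O - O * h) (O * h)
    rw [sub_add_cancel] at this
    exact eq_sub_of_add_eq this.symm
  have h2 : star (influenceForm j O (h * O)) = influenceForm j O (h * O) := by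
    rw [← influenceForm_mul_left hh hS hj O O, influenceForm, star_pauliForm]
    exact (influenceForm_mul_left hh hS hj O O).symm
  have h3 : star (influenceForm j O (O * h)) = influenceForm j O (O * h) := by
    rw [← influenceForm_mul_right hh hS hj O O, influenceForm, star_pauliForm]
    exact (influenceForm_mul_right hh hS hj O O).symm
  have h4 : (influenceForm j O (h * O - O * h)).im = 0 := by
    rw [← Complex.conj_eq_iff_im, ← Complex.star_def, h1, star_sub, h2, h3]
  rw [influenceForm, pauliForm_smul_right]
  change (-Complex.I * influenceForm j O (h * O - O * h)).re = 0
  simp [h4]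

/-! ### The normalized Hilbert-Schmidt norm -/

lemma opInner_self_re (O : Op n d) :
    (opInner O O).re = (1 / (d : ℝ) ^ n) * ∑ p, ∑ q, ‖O p q‖ ^ 2 := by
  have h : opInner O O = (((1 / (d : ℝ) ^ n) * ∑ p, ∑ q, ‖O p q‖ ^ 2 : ℝ) : ℂ) := by
    rw [opInner_eq_sum]
    simp only [Complex.star_def, Complex.conj_mul']
    push_cast
    rfl
  rw [h, Complex.ofReal_re]

lemma norm2_eq (O : Op n d) : norm2 O = √((1 / (d : ℝ) ^ n) * ∑ p, ∑ q, ‖O p q‖ ^ 2) := by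
  rw [norm2, opInner_self_re]

lemma norm2_conjTranspose (O : Op n d) : norm2 Oᴴ = norm2 O := by
  rw [norm2_eq, norm2_eq, Finset.sum_comm]
  simp only [Matrix.conjTranspose_apply, norm_star]

lemma norm2_one : norm2 (1 : Op n d) = 1 := by
  have hd : (d : ℝ) ≠ 0 := Nat.cast_ne_zero.2 (NeZero.ne d)
  rw [norm2_eq]
  have : ∀ p q : QIdx n d, ‖(1 : Op n d) p q‖ ^ 2 = if p = q then 1 else 0 := by
    intro p q
    by_cases h : p = q <;> simp [Matrix.one_apply, h]
  simp only [this]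
  simp [ZMod.card, hd]

lemma norm2_conj_unitary {V : Op n d} (hV : Vᴴ * V = 1) (O : Op n d) :
    norm2 (V * O * Vᴴ) = norm2 O := by
  have h : ((V * O * Vᴴ)ᴴ * (V * O * Vᴴ)).trace = (Oᴴ * O).trace := by
    calc ((V * O * Vᴴ)ᴴ * (V * O * Vᴴ)).trace = (V * (Oᴴ * (Vᴴ * V) * O * Vᴴ)).trace := by
          simp only [Matrix.conjTranspose_mul, Matrix.conjTranspose_conjTranspose,
            Matrix.mul_assoc]
      _ = (Oᴴ * O).trace := by
          rw [Matrix.trace_mul_comm, hV, Matrix.mul_one, Matrix.mul_assoc, hV, Matrix.mul_one]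
  rw [norm2, norm2, opInner, opInner, h]

lemma norm2_mul_le (h O : Op n d) : norm2 (h * O) ≤ opNorm h * norm2 O := by
  have hcol : ∀ q, ∑ p, ‖(h * O) p q‖ ^ 2 ≤ opNorm h ^ 2 * ∑ p, ‖O p q‖ ^ 2 := by
    intro q
    -- Apply the operator norm bound to the `q`-th column of `O`.
    have hle := (Matrix.toEuclideanCLM (n := QIdx n d) (𝕜 := ℂ) h).le_opNorm
      (WithLp.toLp 2 fun p => O p q)
    have hsq := pow_le_pow_left₀ (norm_nonneg _) hle 2
    rw [mul_pow, EuclideanSpace.norm_sq_eq, EuclideanSpace.norm_sq_eq] at hsq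
    exact hsq
  have h0 : 0 ≤ opNorm h := norm_nonneg _
  rw [norm2_eq, norm2_eq]
  conv_rhs => rw [← Real.sqrt_sq h0, ← Real.sqrt_mul (sq_nonneg _)]
  apply Real.sqrt_le_sqrt
  rw [mul_left_comm, Finset.sum_comm, Finset.sum_comm (f := fun p q => ‖O p q‖ ^ 2)]
  refine mul_le_mul_of_nonneg_left ?_ (by positivity)
  rw [Finset.mul_sum]
  exact Finset.sum_le_sum fun q _ => hcol q

lemma norm2_mul_le_of_isHermitian {h : Op n d} (hh : h.IsHermitian) (O : Op n d) :
    norm2 (O * h) ≤ opNorm h * norm2 O := by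
  rw [← norm2_conjTranspose, Matrix.conjTranspose_mul, hh.eq, ← norm2_conjTranspose O]
  exact norm2_mul_le h Oᴴ

/-! ### Attainment of the circuit sensitivity -/

lemma continuous_norm2 : Continuous (norm2 : Op n d → ℝ) := by
  simp only [funext norm2_eq]
  exact Real.continuous_sqrt.comp (continuous_const.mul (continuous_finsetSum _ fun p _ =>
    continuous_finsetSum _ fun q _ => (continuous_id.matrix_elem p q).norm.pow 2))

lemma continuous_influence : Continuous (influence : Op n d → ℝ) := by
  unfold influence localInfluence pauliWeight
  exact continuous_finsetSum _ fun j _ => continuous_finsetSum _ fun a _ =>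
    continuous_const.mul ((continuous_id.matrix_mul continuous_const).matrix_trace.norm.pow 2)

/-- The unit sphere is closed, and its elements have entries of modulus at most `√(d^n)`. -/
lemma isCompact_norm2_eq_one : IsCompact {O : Op n d | norm2 O = 1} := by
  have hd : (0 : ℝ) < (d : ℝ) ^ n := pow_pos (Nat.cast_pos.2 (NeZero.pos d)) n
  have hbox : IsCompact (Set.univ.pi fun _ : QIdx n d => Set.univ.pi fun _ : QIdx n d =>
      Metric.closedBall (0 : ℂ) √((d : ℝ) ^ n)) :=
    isCompact_univ_pi fun _ => isCompact_univ_pi fun _ => isCompact_closedBall _ _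
  refine IsCompact.of_isClosed_subset (X := Op n d) hbox
    (isClosed_eq continuous_norm2 continuous_const) fun O hO p _ q _ => ?_
  rw [mem_closedBall_zero_iff]
  apply Real.le_sqrt_of_sq_le
  have h1 : (1 / (d : ℝ) ^ n) * ∑ p, ∑ q, ‖O p q‖ ^ 2 = 1 := by
    rw [Set.mem_ofPred_eq, norm2_eq, Real.sqrt_eq_one] at hO
    exact hO
  have h2 : ∑ p, ∑ q, ‖O p q‖ ^ 2 = (d : ℝ) ^ n := by
    field_simp at h1
    exact h1
  rw [← h2]
  calc ‖O p q‖ ^ 2 ≤ ∑ q, ‖O p q‖ ^ 2 :=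
        Finset.single_le_sum (f := fun q => ‖O p q‖ ^ 2) (fun _ _ => by positivity)
          (Finset.mem_univ q)
    _ ≤ _ := Finset.single_le_sum (f := fun p => ∑ q, ‖O p q‖ ^ 2)
          (fun _ _ => by positivity) (Finset.mem_univ p)

lemma isGreatest_CiS (U : Op n d) : IsGreatest (influenceChanges U) (CiS U) := by
  have himage : influenceChanges U =
      (fun O => |influence (U * O * Uᴴ) - influence O|) '' {O : Op n d | norm2 O = 1} := by
    ext c
    constructor
    · rintro ⟨O, hO, rfl⟩; exact ⟨O, hO, rfl⟩
    · rintro ⟨O, hO, rfl⟩; exact ⟨O, hO, rfl⟩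
  have hcont : Continuous fun O : Op n d => |influence (U * O * Uᴴ) - influence O| :=
    ((continuous_influence.comp ((continuous_const.matrix_mul continuous_id).matrix_mul
      continuous_const)).sub continuous_influence).abs
  have hcomp : IsCompact (influenceChanges U) := by
    rw [himage]
    exact isCompact_norm2_eq_one.image hcont
  exact hcomp.isGreatest_sSup ⟨_, 1, norm2_one, rfl⟩

/-! ### The rate of change of the influence -/

/-- Each qudit in the support of `h` contributes at most `2`, and the others contribute nothing. -/
lemma abs_sum_influenceForm_commutator_le {S : Finset (Fin n)} (hcard : S.card ≤ 2) {h O : Op n d}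
    (hh : h.IsHermitian) (hS : SupportedOn S h) (hnorm : opNorm h = 1) (hO : norm2 O = 1) :
    |∑ j, (influenceForm j O (-Complex.I • (h * O - O * h))).re| ≤ 4 := by
  have hterm : ∀ j, |(influenceForm j O (-Complex.I • (h * O - O * h))).re| ≤
      if j ∈ S then 2 else 0 := by
    intro j
    by_cases hj : j ∈ S
    · rw [if_pos hj]
      have h1 : influenceForm j O (-Complex.I • (h * O - O * h)) =
          -Complex.I * influenceForm j O (h * O) + Complex.I * influenceForm j O (O * h) := by
        simp only [influenceForm]
        rw [← pauliForm_smul_right, ← pauliForm_smul_right, ← pauliForm_add_right]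
        congr 1
        rw [smul_sub, neg_smul, neg_smul, sub_neg_eq_add]
      have h2 : ‖influenceForm j O (h * O)‖ ≤ 1 := by
        refine (norm_pauliForm_le _ _ _).trans ?_
        have := norm2_mul_le h O
        rw [hO, hnorm] at *
        linarith
      have h3 : ‖influenceForm j O (O * h)‖ ≤ 1 := by
        refine (norm_pauliForm_le _ _ _).trans ?_
        have := norm2_mul_le_of_isHermitian hh O
        rw [hO, hnorm] at *
        linarith
      refine (Complex.abs_re_le_norm _).trans ?_
      rw [h1]
      refine (norm_add_le _ _).trans ?_
      rw [norm_mul, norm_mul, norm_neg, Complex.norm_I]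
      linarith
    · rw [if_neg hj, influenceForm_commutator_eq_zero hh hS hj, abs_zero]
  calc |∑ j, (influenceForm j O (-Complex.I • (h * O - O * h))).re|
      ≤ ∑ j, if j ∈ S then (2 : ℝ) else 0 :=
        (Finset.abs_sum_le_sum_abs _ _).trans (Finset.sum_le_sum fun j _ => hterm j)
    _ = S.card * 2 := by simp
    _ ≤ 4 := by
        have : (S.card : ℝ) ≤ 2 := by exact_mod_cast hcard
        linarith

lemma influenceForm_smul_right (j : Fin n) (A B : Op n d) (z : ℂ) :
    influenceForm j A (z • B) = z * influenceForm j A B :=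
  pauliForm_smul_right _ A B z

lemma influenceForm_sum_right {ι : Type*} (s : Finset ι) (j : Fin n) (A : Op n d)
    (B : ι → Op n d) : influenceForm j A (∑ i ∈ s, B i) = ∑ i ∈ s, influenceForm j A (B i) := by
  classical
  induction s using Finset.induction_on with
  | empty => simp [influenceForm, pauliForm]
  | insert i s hi ih =>
    rw [Finset.sum_insert hi, Finset.sum_insert hi, ← ih]
    exact pauliForm_add_right _ _ _ _

lemma abs_sum_influenceForm_hamiltonian_le {m : ℕ} {h : Fin m → Op n d}
    (h_herm : ∀ i, (h i).IsHermitian)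
    (h_local : ∀ i, ∃ S : Finset (Fin n), S.card ≤ 2 ∧ SupportedOn S (h i))
    (h_norm : ∀ i, opNorm (h i) = 1) (r : Fin m → ℝ) {O : Op n d} (hO : norm2 O = 1) :
    |∑ j, (influenceForm j O (-Complex.I • ((∑ i, (r i : ℂ) • h i) * O -
      O * ∑ i, (r i : ℂ) • h i))).re| ≤ 4 * ∑ i, |r i| := by
  have hcomm : -Complex.I • ((∑ i, (r i : ℂ) • h i) * O - O * ∑ i, (r i : ℂ) • h i) =
      ∑ i, (r i : ℂ) • (-Complex.I • (h i * O - O * h i)) := by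
    rw [Finset.sum_mul, Finset.mul_sum, ← Finset.sum_sub_distrib, Finset.smul_sum]
    refine Finset.sum_congr rfl fun i _ => ?_
    rw [smul_comm, Matrix.smul_mul, Matrix.mul_smul, ← smul_sub, smul_comm]
  simp only [hcomm, influenceForm_sum_right, influenceForm_smul_right _ _ _ ((r _ : ℝ) : ℂ),
    Complex.re_sum, Complex.re_ofReal_mul]
  rw [Finset.sum_comm, Finset.mul_sum]
  refine (Finset.abs_sum_le_sum_abs _ _).trans (Finset.sum_le_sum fun i _ => ?_)
  obtain ⟨S, hcard, hS⟩ := h_local i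
  rw [← Finset.mul_sum, abs_mul, mul_comm]
  exact mul_le_mul_of_nonneg_right
    (abs_sum_influenceForm_commutator_le hcard (h_herm i) hS (h_norm i) hO) (abs_nonneg _)

/-! ### Entrywise differentiation of operator-valued curves -/

section Derivatives

variable {A B : ℝ → Op n d} {A' B' : Op n d} {s : Set ℝ} {t : ℝ}

lemma hasDerivWithinAt_mul_entry
    (hA : ∀ x y, HasDerivWithinAt (fun τ => A τ x y) (A' x y) s t)
    (hB : ∀ x y, HasDerivWithinAt (fun τ => B τ x y) (B' x y) s t) (x y : QIdx n d) :
    HasDerivWithinAt (fun τ => (A τ * B τ) x y) ((A' * B t + A t * B') x y) s t := by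
  simp only [Matrix.add_apply, Matrix.mul_apply, ← Finset.sum_add_distrib]
  exact HasDerivWithinAt.fun_sum fun z _ => (hA x z).mul (hB z y)

lemma hasDerivWithinAt_conjTranspose_entry {ι : Type*} {A : ℝ → Matrix ι ι ℂ} {A' : Matrix ι ι ℂ}
    (hA : ∀ x y, HasDerivWithinAt (fun τ => A τ x y) (A' x y) s t) (x y : ι) :
    HasDerivWithinAt (fun τ => (A τ)ᴴ x y) (A'ᴴ x y) s t := by
  simpa only [Matrix.conjTranspose_apply] using (hA y x).star

lemma hasDerivWithinAt_mul_const_entry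
    (hA : ∀ x y, HasDerivWithinAt (fun τ => A τ x y) (A' x y) s t) (C : Op n d) (x y : QIdx n d) :
    HasDerivWithinAt (fun τ => (A τ * C) x y) ((A' * C) x y) s t := by
  simpa using hasDerivWithinAt_mul_entry hA (B := fun _ => C) (B' := 0)
    (fun _ _ => hasDerivWithinAt_const _ _ _) x y

lemma hasDerivWithinAt_influence
    (hA : ∀ x y, HasDerivWithinAt (fun τ => A τ x y) (A' x y) s t) :
    HasDerivWithinAt (fun τ => influence (A τ)) (2 * ∑ j, (influenceForm j (A t) A').re) s t := by
  have hweight : ∀ a, HasDerivWithinAt (fun τ => pauliWeight (A τ) a)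
      ((1 / (d : ℝ) ^ (2 * n)) *
        (2 * (star (A t * pauli a).trace * (A' * pauli a).trace).re)) s t := by
    intro a
    have htr : HasDerivWithinAt (fun τ => (A τ * pauli a).trace) (A' * pauli a).trace s t :=
      HasDerivWithinAt.fun_sum fun x _ => hasDerivWithinAt_mul_const_entry hA (pauli a) x x
    have h := htr.norm_sq.const_mul (1 / (d : ℝ) ^ (2 * n))
    rw [Complex.inner, mul_comm (A' * pauli a).trace] at h
    exact h
  rw [Finset.mul_sum]
  refine HasDerivWithinAt.fun_sum fun j _ => ?_
  have hj : 2 * (influenceForm j (A t) A').re = ∑ a with a j ≠ (0, 0),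
      (1 / (d : ℝ) ^ (2 * n)) *
        (2 * (star (A t * pauli a).trace * (A' * pauli a).trace).re) := by
    have hc : (1 / (d : ℂ) ^ (2 * n)) = ((1 / (d : ℝ) ^ (2 * n) : ℝ) : ℂ) := by push_cast; rfl
    rw [influenceForm, pauliForm, hc, Complex.re_ofReal_mul, Complex.re_sum, ← Finset.mul_sum,
      ← Finset.mul_sum]
    ring
  rw [hj]
  exact HasDerivWithinAt.fun_sum fun a _ => hweight a

end Derivatives

/-! ### Evolution along a controlled Hamiltonian -/

section Evolution

variable {H V : ℝ → Op n d}

lemma conjTranspose_neg_I_smul_mul {K W : Op n d} (hK : K.IsHermitian) :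
    (-Complex.I • (K * W))ᴴ = Complex.I • (Wᴴ * K) := by
  rw [Matrix.conjTranspose_smul, Matrix.conjTranspose_mul, hK.eq]
  simp

/-- The solution of `V' = -i H V`, `V 0 = 1` with `H` Hermitian is unitary. -/
lemma conjTranspose_mul_self_of_schrodinger (hH : ∀ s, (H s).IsHermitian) (h0 : V 0 = 1)
    (hV : ∀ s ∈ Set.Icc (0 : ℝ) 1, ∀ x y,
      HasDerivWithinAt (fun t => V t x y) ((-Complex.I • (H s * V s)) x y) (Set.Icc 0 1) s)
    {s : ℝ} (hs : s ∈ Set.Icc (0 : ℝ) 1) : (V s)ᴴ * V s = 1 := by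
  ext x y
  have hder : ∀ t ∈ Set.Icc (0 : ℝ) 1,
      HasDerivWithinAt (fun τ => ((V τ)ᴴ * V τ) x y) 0 (Set.Icc 0 1) t := by
    intro t ht
    have h := hasDerivWithinAt_mul_entry (hasDerivWithinAt_conjTranspose_entry (hV t ht))
      (hV t ht) x y
    have hz : (-Complex.I • (H t * V t))ᴴ * V t + (V t)ᴴ * -Complex.I • (H t * V t) = 0 := by
      rw [conjTranspose_neg_I_smul_mul (hH t), Matrix.smul_mul, Matrix.mul_smul, neg_smul,
        Matrix.mul_assoc, add_neg_cancel]
    rw [hz] at h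
    exact h
  have hconst := constant_of_has_deriv_right_zero
    (fun t ht => (hder t ht).continuousWithinAt)
    (fun t ht => (hder t (Set.Ico_subset_Icc_self ht)).mono_of_mem_nhdsWithin
      (Icc_mem_nhdsGE_of_mem ht)) s hs
  rw [hconst, h0]
  simp

/-- The evolved operator `O(t) = V(t) O V(t)†` satisfies `O' = -i [H, O]`. -/
lemma hasDerivWithinAt_influence_evolution (hH : ∀ s, (H s).IsHermitian)
    (hV : ∀ s ∈ Set.Icc (0 : ℝ) 1, ∀ x y,
      HasDerivWithinAt (fun t => V t x y) ((-Complex.I • (H s * V s)) x y) (Set.Icc 0 1) s)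
    (O : Op n d) {s : ℝ} (hs : s ∈ Set.Icc (0 : ℝ) 1) :
    HasDerivWithinAt (fun t => influence (V t * O * (V t)ᴴ))
      (2 * ∑ j, (influenceForm j (V s * O * (V s)ᴴ) (-Complex.I •
        (H s * (V s * O * (V s)ᴴ) - V s * O * (V s)ᴴ * H s))).re) (Set.Icc 0 1) s := by
  have hcomm : -Complex.I • (H s * V s) * O * (V s)ᴴ +
      V s * O * (-Complex.I • (H s * V s))ᴴ =
      -Complex.I • (H s * (V s * O * (V s)ᴴ) - V s * O * (V s)ᴴ * H s) := by
    rw [conjTranspose_neg_I_smul_mul (hH s), smul_sub, sub_eq_add_neg, ← neg_smul, neg_neg]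
    simp only [Matrix.smul_mul, Matrix.mul_smul, Matrix.mul_assoc]
  rw [← hcomm]
  exact hasDerivWithinAt_influence (hasDerivWithinAt_mul_entry
    (hasDerivWithinAt_mul_const_entry (hV s hs) O)
    (hasDerivWithinAt_conjTranspose_entry (hV s hs)))

end Evolution

lemma abs_influence_sub_le {m : ℕ} {h : Fin m → Op n d} (h_herm : ∀ i, (h i).IsHermitian)
    (h_local : ∀ i, ∃ S : Finset (Fin n), S.card ≤ 2 ∧ SupportedOn S (h i))
    (h_norm : ∀ i, opNorm (h i) = 1) {r : Fin m → ℝ → ℝ}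
    (hr : ∀ i, ContinuousOn (r i) (Set.Icc 0 1)) {U : Op n d}
    (hU : IsPathOrderedExp (fun s => ∑ i, (r i s : ℂ) • h i) U) {O : Op n d} (hO : norm2 O = 1) :
    |influence (U * O * Uᴴ) - influence O| ≤ 8 * ∫ s in (0 : ℝ)..1, ∑ i, |r i s| := by
  obtain ⟨V, h0, h1, hV⟩ := hU
  have hH : ∀ s, (∑ i, (r i s : ℂ) • h i).IsHermitian := by
    intro s
    rw [Matrix.IsHermitian, Matrix.conjTranspose_sum]
    refine Finset.sum_congr rfl fun i _ => ?_
    rw [Matrix.conjTranspose_smul, (h_herm i).eq, Complex.star_def, Complex.conj_ofReal]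
  have hder := fun s hs => hasDerivWithinAt_influence_evolution hH hV O (s := s) hs
  have hdiff : ∀ s ∈ Set.Ioo (0 : ℝ) 1, HasDerivAt _ _ s := fun s hs =>
    (hder s (Set.Ioo_subset_Icc_self hs)).hasDerivAt (Icc_mem_nhds hs.1 hs.2)
  have hint : IntervalIntegrable (fun s => 8 * ∑ i, |r i s|) MeasureTheory.volume 0 1 := by
    apply ContinuousOn.intervalIntegrable
    rw [Set.uIcc_of_le zero_le_one]
    exact continuousOn_const.mul (continuousOn_finsetSum _ fun i _ => (hr i).abs)
  have hmain := norm_sub_le_integral_of_norm_deriv_le_of_le zero_le_one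
    (fun s hs => (hder s hs).continuousWithinAt)
    (fun s hs => (hdiff s hs).differentiableAt.differentiableWithinAt)
    (Filter.Eventually.of_forall fun s hs => ?_) hint
  · rw [h0, h1, intervalIntegral.integral_const_mul, Real.norm_eq_abs] at hmain
    simpa using hmain
  · have hn : norm2 (V s * O * (V s)ᴴ) = 1 := by
      rw [norm2_conj_unitary (conjTranspose_mul_self_of_schrodinger hH h0 hV
        (Set.Ioo_subset_Icc_self hs)), hO]
    have hb := abs_sum_influenceForm_hamiltonian_le h_herm h_local h_norm (fun i => r i s) hn
    rw [(hdiff s hs).deriv, Real.norm_eq_abs, abs_mul, abs_two]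
    linarith

end QuditCircuit

theorem theorem3 (n d m : ℕ) [NeZero d]
    (h : Fin m → QuditCircuit.Op n d)
    (h_herm : ∀ j, (h j).IsHermitian)
    (h_traceless : ∀ j, (h j).trace = 0)
    (h_local : ∀ j, ∃ S : Finset (Fin n), S.card ≤ 2 ∧ QuditCircuit.SupportedOn S (h j))
    (h_norm : ∀ j, QuditCircuit.opNorm (h j) = 1)
    (U : Matrix.specialUnitaryGroup (QuditCircuit.QIdx n d) ℂ) :
    IsGreatest (QuditCircuit.influenceChanges (U : QuditCircuit.Op n d))
        (QuditCircuit.CiS (U : QuditCircuit.Op n d)) ∧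
      ENNReal.ofReal (QuditCircuit.CiS (U : QuditCircuit.Op n d) / 8) ≤
        QuditCircuit.cost h (U : QuditCircuit.Op n d) := by
  have hmax := QuditCircuit.isGreatest_CiS (U : QuditCircuit.Op n d)
  refine ⟨hmax, le_iInf fun r => le_iInf fun hr => le_iInf fun hU => ENNReal.ofReal_le_ofReal ?_⟩
  obtain ⟨O, hO, hc⟩ := hmax.1
  have := QuditCircuit.abs_influence_sub_le h_herm h_local h_norm hr hU hO
  rw [hc]
  linarith
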